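/- Let $f$ be a centered Gaussian field on $\mathbb{R}^2$ which is normalized ($\mathrm{Var}(f(x))=1$ for every $x$), non-degenerate (for pairwise distinct $x_1,\dots,x_k$ the covariance matrix of $(f(x_1),\dots,f(x_k))$ is invertible), stationary and a.s. continuous, and let $\kappa$ be its covariance function, $\mathbb{E}[f(x)f(y)]=\kappa(y-x)$. Let $\mathcal{T}=(\mathcal{V},\mathcal{E})$ be the face-centered square lattice: its vertices are the points of $\mathbb{Z}^2$ and the centers of the unit squares of $\mathbb{Z}^2$; its edges join nearest neighbours of $\mathbb{Z}^2$, and each center to the four corners of its square. Let $\mathcal{T}^\varepsilon=(\mathcal{V}^\varepsilon,\mathcal{E}^\varepsilon)$ be this lattice scaled by $\varepsilon>0$. For $p\in\mathbb{R}$ and $\rho_1,\rho_2>0$: - $\mathrm{Cross}_p(\rho_1,\rho_2)$ is the event that there is a continuous path in $\{x : f(x)\ge -p\}\cap([0,\rho_1]\times[0,\rho_2])$ joining the left side of $[0,\rho_1]\times[0,\rho_2]$ to its right side; - a point $x$ is called black (at level $p$ and mesh $\varepsilon$) if $x\in\mathcal{V}^\varepsilon$ and $f(x)\ge -p$, or if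 $x$ lies on an edge of $\mathcal{E}^\varepsilon$ at both of whose endpoints $f\ge -p$; $\mathrm{Cross}^\varepsilon_p(\rho_1,\rho_2)$ is the event that there is a continuous path of black points in $[0,\rho_1]\times[0,\rho_2]$ joining the left side to the right side. Assume that $f$ is a.s. $C^2$ and let $p>0$. Then there exist an absolute constant $C_1<+\infty$ and constants $c_2=c_2(\kappa,p)>0$ and $\varepsilon_0=\varepsilon_0(\kappa,p)>0$ such that for each $\varepsilon\in\,]0,\varepsilon_0]$ and each $R>1$, $$\mathbb{P}\left[\mathrm{Cross}^\varepsilon_{p/2}(2R,R)\setminus \mathrm{Cross}_p(2R,R)\right]\le C_1R^2\varepsilon^{-2}\exp(-c_2\varepsilon^{-4}).$$ In particular, for every family $(\varepsilon(R))_{R>0}$ of positive numbers such that, for some $\delta>0$, $\varepsilon(R)\le \log^{-(1/4+\delta)}(R)$ for all large enough $R$, $$\mathbb{P}\left[\mathrm{Cross}^{\varepsilon(R)}_{p/2}(2R,R)\setminus \mathrm{Cross}_p(2R,R)\right]\longrightarrow 0\quad\text{as } R\to+\infty.$$ -/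

import Mathlib

open MeasureTheory ProbabilityTheory Filter Topology

namespace PlanarPercolation

/-- The plane `ℝ²`. Only its vector space structure, topology and coordinates are used below. -/
abbrev Plane : Type := ℝ × ℝ

/-! ### Random fields on the plane -/

/-- The covariance matrix of the vector `(f (x 0), …, f (x (k-1)))`. -/
noncomputable def covMatrix {Ω : Type*} [MeasurableSpace Ω] (μ : Measure Ω) (f : Plane → Ω → ℝ)
    {k : ℕ} (x : Fin k → Plane) : Matrix (Fin k) (Fin k) ℝ :=
  Matrix.of fun i j => cov[f (x i), f (x j); μ]

/-- The standing assumption on the planar Gaussian field `f`: it is a non-degenerate, centered,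
normalized, (almost surely) continuous and stationary Gaussian field. -/
structure IsStandardField {Ω : Type*} [MeasurableSpace Ω] (μ : Measure Ω)
    (f : Plane → Ω → ℝ) : Prop where
  gaussian : IsGaussianProcess f μ
  nondegenerate : ∀ (k : ℕ) (x : Fin k → Plane), Function.Injective x →
    IsUnit (covMatrix μ f x)
  centered : ∀ x, ∫ ω, f x ω ∂μ = 0
  normalized : ∀ x, Var[f x; μ] = 1
  continuous : ∀ᵐ ω ∂μ, Continuous fun x => f x ω
  /-- the finite-dimensional distributions are invariant under all translations -/
  stationary : ∀ (h : Plane) (k : ℕ) (x : Fin k → Plane),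
    IdentDistrib (fun ω (i : Fin k) => f (x i + h) ω) (fun ω (i : Fin k) => f (x i) ω) μ μ

/-- `κ` is the covariance function of the field: `𝔼[f(x) f(y)] = κ(y - x)`. -/
def HasCovariance {Ω : Type*} [MeasurableSpace Ω] (μ : Measure Ω) (f : Plane → Ω → ℝ)
    (κ : Plane → ℝ) : Prop :=
  ∀ x y, ∫ ω, f x ω * f y ω ∂μ = κ (y - x)

/-! ### The face-centered square lattice -/

/-- The points of `ℤ²`. -/
def cornerPoints : Set Plane := {x | ∃ m n : ℤ, x = ((m : ℝ), (n : ℝ))}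

/-- The centers of the unit squares of `ℤ²`. -/
def centerPoints : Set Plane := {x | ∃ m n : ℤ, x = ((m : ℝ) + 1 / 2, (n : ℝ) + 1 / 2)}

/-- The vertices of the face-centered square lattice. -/
def latticeVertices : Set Plane := cornerPoints ∪ centerPoints

/-- Adjacency in the face-centered square lattice: two points of `ℤ²` are adjacent when they are
nearest neighbours, and the center of a unit square is adjacent to the four corners of that
square. -/
def LatticeAdj (x y : Plane) : Prop :=
  (x ∈ cornerPoints ∧ y ∈ cornerPoints ∧ |y.1 - x.1| + |y.2 - x.2| = 1) ∨
  (x ∈ cornerPoints ∧ y ∈ centerPoints ∧ |y.1 - x.1| = 1 / 2 ∧ |y.2 - x.2| = 1 / 2) ∨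
  (x ∈ centerPoints ∧ y ∈ cornerPoints ∧ |y.1 - x.1| = 1 / 2 ∧ |y.2 - x.2| = 1 / 2)

/-- The vertices of the lattice scaled by `ε`. -/
def scaledVertices (ε : ℝ) : Set Plane := {x | ∃ a ∈ latticeVertices, x = ε • a}

/-- Adjacency in the lattice scaled by `ε`. -/
def ScaledAdj (ε : ℝ) (x y : Plane) : Prop :=
  ∃ a b : Plane, LatticeAdj a b ∧ x = ε • a ∧ y = ε • b

/-! ### Continuum and discrete crossings of rectangles

Here `g` is one realization of the field. -/

/-- The excursion set `D_p = g⁻¹([-p, ∞))`. -/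
def excursionSet (g : Plane → ℝ) (p : ℝ) : Set Plane := {x | -p ≤ g x}

/-- The black points of the discrete model at parameter `p` and mesh `ε`: the vertices where
`g ≥ -p`, and the points of the edges both of whose endpoints satisfy `g ≥ -p`. -/
def blackSet (g : Plane → ℝ) (ε p : ℝ) : Set Plane :=
  {x | x ∈ scaledVertices ε ∧ -p ≤ g x} ∪
  {x | ∃ y₁ y₂ : Plane, ScaledAdj ε y₁ y₂ ∧ x ∈ segment ℝ y₁ y₂ ∧ -p ≤ g y₁ ∧ -p ≤ g y₂}

/-- The rectangle `[0,ρ₁] × [0,ρ₂]`. -/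
def rectangle (ρ₁ ρ₂ : ℝ) : Set Plane := Set.Icc 0 ρ₁ ×ˢ Set.Icc 0 ρ₂

/-- There is a continuous path in `S ∩ [0,ρ₁] × [0,ρ₂]` joining the left side of the rectangle
`[0,ρ₁] × [0,ρ₂]` to its right side. -/
def HasCrossing (S : Set Plane) (ρ₁ ρ₂ : ℝ) : Prop :=
  ∃ a b : Plane, a.1 = 0 ∧ b.1 = ρ₁ ∧ JoinedIn (S ∩ rectangle ρ₁ ρ₂) a b

/-- The event `Cross_p(ρ₁,ρ₂)`. -/
def crossEvent {Ω : Type*} (f : Plane → Ω → ℝ) (p ρ₁ ρ₂ : ℝ) : Set Ω :=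
  {ω | HasCrossing (excursionSet (fun x => f x ω) p) ρ₁ ρ₂}

/-- The event `Cross_p^ε(ρ₁,ρ₂)`. -/
def discreteCrossEvent {Ω : Type*} (f : Plane → Ω → ℝ) (ε p ρ₁ ρ₂ : ℝ) : Set Ω :=
  {ω | HasCrossing (blackSet (fun x => f x ω) ε p) ρ₁ ρ₂}

end PlanarPercolation

namespace PlanarPercolation

open scoped ENNReal

/-! ### Gaussian vectors and Fernique's bound -/

/-! If the discrete model crosses and the continuum does not, the discrete path itself leaves the
excursion set, so along some edge `f` is at least `-p/2` at both ends but falls below `-p` in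
between (`discreteCrossEvent_diff_subset`). There the error of linear interpolation exceeds `p/2`.
For a `C²` field this error is quadratic in the edge length, so a dip on an edge of length at most
`ε` forces an error, rescaled by the squared length, above `p/(2ε²)`. The rescaled errors form an
a.s. bounded Gaussian family (`exists_abs_defect_le`), hence Fernique's bound gives a tail `exp(-c
t²)` at `t = p/(2ε²)`, which is the `ε⁻⁴` in the exponent (`exists_dip_rate`). A union bound over
`O(R²ε⁻²)` edges concludes.

The prefactor is absolute because Fernique's constant depends only on the quantile level, fixed at
`3/4`; the quantile itself enters only the rate, and it can be read off from a single field with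
covariance `κ`. -/

lemma _root_.ContinuousLinearMap.pi_apply_eq_sum {ι : Type*} [Fintype ι]
    (L : StrongDual ℝ (ι → ℝ)) : ∃ l : ι → ℝ, ∀ v, L v = ∑ i, l i * v i := by
  classical
  refine ⟨fun i => L (Pi.single i 1), fun v => ?_⟩
  conv_lhs => rw [pi_eq_sum_univ' v, map_sum]
  refine Finset.sum_congr rfl fun i _ => ?_
  rw [map_smul, smul_eq_mul, mul_comm]

section GaussianVector

variable {Ω : Type*} [MeasurableSpace Ω] {μ : Measure Ω} {ι : Type*} [Fintype ι] {X : ι → Ω → ℝ}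

lemma memLp_two_coord (hX : HasGaussianLaw (fun ω i => X i ω) μ) (i : ι) : MemLp (X i) 2 μ :=
  (hX.map_fun (ContinuousLinearMap.proj (R := ℝ) (φ := fun _ : ι => ℝ) i)).memLp_two

lemma integral_dual_eq_zero (hX : HasGaussianLaw (fun ω i => X i ω) μ)
    (h0 : ∀ i, ∫ ω, X i ω ∂μ = 0) (L : StrongDual ℝ (ι → ℝ)) :
    ∫ ω, L (fun i => X i ω) ∂μ = 0 := by
  have := hX.isProbabilityMeasure
  obtain ⟨l, hl⟩ := L.pi_apply_eq_sum
  simp_rw [hl]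
  rw [integral_finsetSum]
  · simp [integral_const_mul, h0]
  · exact fun i _ => ((memLp_two_coord hX i).integrable one_le_two).const_mul _

lemma integral_dual_sq (hX : HasGaussianLaw (fun ω i => X i ω) μ) (l : ι → ℝ) :
    ∫ ω, (∑ i, l i * X i ω) ^ 2 ∂μ = ∑ i, ∑ j, l i * l j * ∫ ω, X i ω * X j ω ∂μ := by
  have := hX.isProbabilityMeasure
  have hint : ∀ i j, Integrable (fun ω => l i * l j * (X i ω * X j ω)) μ := fun i j =>
    ((memLp_two_coord hX i).integrable_mul (memLp_two_coord hX j)).const_mul _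
  have : ∀ ω, (∑ i, l i * X i ω) ^ 2 = ∑ i, ∑ j, l i * l j * (X i ω * X j ω) := fun ω => by
    rw [sq, Finset.sum_mul_sum]
    exact Finset.sum_congr rfl fun i _ => Finset.sum_congr rfl fun j _ => by ring
  simp_rw [this]
  rw [integral_finsetSum _ fun i _ => integrable_finsetSum _ fun j _ => hint i j]
  refine Finset.sum_congr rfl fun i _ => ?_
  rw [integral_finsetSum _ fun j _ => hint i j]
  exact Finset.sum_congr rfl fun j _ => integral_const_mul _ _

/-- The law of a centered Gaussian vector is determined by its covariances. -/
lemma map_eq_of_integral_mul_eq {Ω' : Type*} [MeasurableSpace Ω'] {μ' : Measure Ω'}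
    {X' : ι → Ω' → ℝ} (hX : HasGaussianLaw (fun ω i => X i ω) μ)
    (hX' : HasGaussianLaw (fun ω i => X' i ω) μ')
    (h0 : ∀ i, ∫ ω, X i ω ∂μ = 0) (h0' : ∀ i, ∫ ω, X' i ω ∂μ' = 0)
    (hcov : ∀ i j, ∫ ω, X i ω * X j ω ∂μ = ∫ ω, X' i ω * X' j ω ∂μ') :
    μ.map (fun ω i => X i ω) = μ'.map (fun ω i => X' i ω) := by
  have := hX.isProbabilityMeasure
  have := hX'.isProbabilityMeasure
  -- A Gaussian characteristic function at `L` involves only the mean and variance of `L`, and the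
  -- variance is a quadratic form in the covariances.
  refine Measure.ext_of_charFunDual ?_
  ext L
  rw [hX.charFunDual_map_eq_fun L, hX'.charFunDual_map_eq_fun L,
    integral_dual_eq_zero hX h0, integral_dual_eq_zero hX' h0',
    variance_of_integral_eq_zero (hX.map_fun L).aemeasurable (integral_dual_eq_zero hX h0 L),
    variance_of_integral_eq_zero (hX'.map_fun L).aemeasurable (integral_dual_eq_zero hX' h0' L)]
  obtain ⟨l, hl⟩ := L.pi_apply_eq_sum
  simp_rw [hl]
  rw [integral_dual_sq hX, integral_dual_sq hX']
  simp_rw [hcov]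

end GaussianVector

/-- The constant in the Gaussian tail bound `tail_of_quantile`. -/
noncomputable def ferniqueConst : ℝ≥0∞ :=
  .ofReal (Real.exp (Fernique.logRatio (3 / 4)))
    + ∑' n : ℕ, .ofReal (Real.exp (-2⁻¹ * Real.log ((3 / 4 : ℝ≥0∞) / (1 - 3 / 4)).toReal * 2 ^ n))

lemma one_sub_three_quarters : (1 - 3 / 4 : ℝ≥0∞) = 4⁻¹ := by
  refine ENNReal.sub_eq_of_eq_add (by finiteness) ?_
  rw [← ENNReal.toReal_eq_toReal_iff' (by finiteness) (by finiteness),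
    ENNReal.toReal_add (by finiteness) (by finiteness)]
  norm_num

lemma ferniqueConst_lt_top : ferniqueConst < ∞ := by
  refine ENNReal.add_lt_top.mpr ⟨ENNReal.ofReal_lt_top, ?_⟩
  refine Summable.tsum_ofReal_lt_top <|
    Real.summable_exp_nat_mul_of_ge ?_ (fun i ↦ mod_cast (Nat.lt_pow_self (by simp)).le)
  refine mul_neg_of_neg_of_pos (by simp) (Real.log_pos ?_)
  rw [one_sub_three_quarters]
  norm_num

lemma half_lt_three_quarters : (2⁻¹ : ℝ≥0∞) < 3 / 4 := by
  rw [← ENNReal.toReal_lt_toReal (by finiteness) (by finiteness)]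
  norm_num

lemma logRatio_three_quarters_pos : 0 < Fernique.logRatio (3 / 4) := by
  refine Fernique.logRatio_pos half_lt_three_quarters ?_
  rw [← ENNReal.toReal_lt_toReal (by finiteness) (by finiteness)]
  norm_num

/-- A centered Gaussian measure has Gaussian tails that only depend on a quantile of the norm. -/
lemma measure_lt_norm_le {E : Type*} [NormedAddCommGroup E] [NormedSpace ℝ E]
    [SecondCountableTopology E] [CompleteSpace E] [MeasurableSpace E] [BorelSpace E]
    (ν : Measure E) [IsGaussian ν] (h0 : ∀ L : StrongDual ℝ E, ∫ x, L x ∂ν = 0) {a : ℝ}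
    (ha : 3 / 4 ≤ ν {x | ‖x‖ ≤ a}) {t : ℝ} (ht : 0 ≤ t) :
    ν {x | t < ‖x‖} ≤
      ferniqueConst * .ofReal (Real.exp (-(Fernique.logRatio (3 / 4) * a⁻¹ ^ 2 * t ^ 2))) := by
  set c := Fernique.logRatio (3 / 4) * a⁻¹ ^ 2
  have hc : 0 ≤ c := mul_nonneg logRatio_three_quarters_pos.le (by positivity)
  -- Fernique: centering makes `ν ⊗ ν` rotation invariant, which bounds this exponential moment
  -- independently of `a`. Markov's inequality then gives the tail.
  have h1 : ∫⁻ x, .ofReal (Real.exp (c * ‖x‖ ^ 2)) ∂ν ≤ ferniqueConst :=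
    lintegral_exp_mul_sq_norm_le_of_map_rotation_eq_self
      (IsGaussian.map_rotation_eq_self_of_forall_strongDual_eq_zero h0 _) ha half_lt_three_quarters
  have h2 := mul_meas_ge_le_lintegral₀ (μ := ν)
    (f := fun x => ENNReal.ofReal (Real.exp (c * ‖x‖ ^ 2))) (by fun_prop)
    (ENNReal.ofReal (Real.exp (c * t ^ 2)))
  have h3 : ν {x | t < ‖x‖} ≤ ν {x | ENNReal.ofReal (Real.exp (c * t ^ 2)) ≤
      ENNReal.ofReal (Real.exp (c * ‖x‖ ^ 2))} := by
    refine measure_mono fun x hx => ?_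
    have : t < ‖x‖ := hx
    simp only [Set.mem_ofPred_eq]
    gcongr
  rw [Real.exp_neg, ENNReal.ofReal_inv_of_pos (Real.exp_pos _), ← div_eq_mul_inv,
    ENNReal.le_div_iff_mul_le (by simp [Real.exp_pos]) (by simp), mul_comm]
  exact (mul_le_mul_right h3 _).trans (h2.trans h1)

/-! ### Countable families of linear functionals of a Gaussian field -/

/-- The linear functional `∑ j, c j * g (x j)` of a function `g`. -/
def pointFunctional {T J : Type*} [Fintype J] (c : J → ℝ) (x : J → T) (g : T → ℝ) : ℝ :=
  ∑ j, c j * g (x j)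

section Field

variable {T J : Type*} [Fintype J] {Ω : Type*} [MeasurableSpace Ω] {μ : Measure Ω} {f : T → Ω → ℝ}

lemma hasGaussianLaw_points {ι : Type*} [Fintype ι] (hf : IsGaussianProcess f μ) (x : ι → T) :
    HasGaussianLaw (fun ω i => f (x i) ω) μ := by
  have h := (hf.comp_right x).hasGaussianLaw Finset.univ
  let L : ({i // i ∈ (Finset.univ : Finset ι)} → ℝ) →L[ℝ] (ι → ℝ) :=
    ContinuousLinearMap.pi fun i => ContinuousLinearMap.proj ⟨i, Finset.mem_univ i⟩
  exact h.map_fun L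

/-- The vector of the first `N` functionals, as a continuous linear map. -/
noncomputable def functionalVector (c : ℕ → J → ℝ) (N : ℕ) : (Fin N × J → ℝ) →L[ℝ] (Fin N → ℝ) :=
  ContinuousLinearMap.pi fun n => ∑ j, c n j • ContinuousLinearMap.proj (n, j)

lemma functionalVector_apply (c : ℕ → J → ℝ) (x : ℕ → J → T) (N : ℕ) (g : T → ℝ) :
    functionalVector c N (fun i => g (x i.1 i.2)) = fun n : Fin N => pointFunctional (c n) (x n) g := by
  ext n
  simp [functionalVector, pointFunctional]

/-- A quantile of the supremum of countably many functionals of a centered Gaussian field bounds the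
tail of this supremum for every centered Gaussian field with the same covariances. -/
lemma tail_of_quantile {Ω' : Type*} [MeasurableSpace Ω'] {μ' : Measure Ω'}
    {f' : T → Ω' → ℝ} (hf : IsGaussianProcess f μ) (hf' : IsGaussianProcess f' μ')
    (h0 : ∀ x, ∫ ω, f x ω ∂μ = 0) (h0' : ∀ x, ∫ ω, f' x ω ∂μ' = 0)
    (hcov : ∀ x y, ∫ ω, f x ω * f y ω ∂μ = ∫ ω, f' x ω * f' y ω ∂μ')
    (c : ℕ → J → ℝ) (x : ℕ → J → T) {a : ℝ} (ha0 : 0 ≤ a)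
    (ha : 3 / 4 ≤ μ {ω | ∀ n, |pointFunctional (c n) (x n) fun y => f y ω| ≤ a})
    {t : ℝ} (ht : 0 ≤ t) :
    μ' {ω | ∃ n, t < |pointFunctional (c n) (x n) fun y => f' y ω|} ≤
      ferniqueConst * .ofReal (Real.exp (-(Fernique.logRatio (3 / 4) * a⁻¹ ^ 2 * t ^ 2))) := by
  -- Truncating to `N` functionals gives a finite-dimensional Gaussian vector whose sup norm is the
  -- maximum. The bound is uniform in `N`, so it passes to the increasing union.
  set A : ℕ → Set Ω' := fun N => {ω | ∃ n < N, t < |pointFunctional (c n) (x n) fun y => f' y ω|}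
  have hA : Monotone A := fun N M hNM ω ⟨n, hn, h⟩ => ⟨n, hn.trans_le hNM, h⟩
  have hU : {ω | ∃ n, t < |pointFunctional (c n) (x n) fun y => f' y ω|} = ⋃ N, A N := by
    ext ω
    simp only [Set.mem_ofPred_eq, Set.mem_iUnion, A]
    exact ⟨fun ⟨n, h⟩ => ⟨n + 1, n, n.lt_succ_self, h⟩, fun ⟨_, n, _, h⟩ => ⟨n, h⟩⟩
  rw [hU, hA.measure_iUnion]
  refine iSup_le fun N => ?_
  have hg := hasGaussianLaw_points hf fun i : Fin N × J => x i.1 i.2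
  have hg' := hasGaussianLaw_points hf' fun i : Fin N × J => x i.1 i.2
  have hlaw := map_eq_of_integral_mul_eq hg hg' (fun _ => h0 _) (fun _ => h0' _)
    (fun _ _ => hcov _ _)
  have hv := hg.map_fun (functionalVector c N)
  have hv' := hg'.map_fun (functionalVector c N)
  have hlaw' : μ.map (fun ω => functionalVector c N fun i => f (x i.1 i.2) ω) =
      μ'.map (fun ω => functionalVector c N fun i => f' (x i.1 i.2) ω) := by
    have := congrArg (fun ν => ν.map (functionalVector c N)) hlaw
    rwa [AEMeasurable.map_map_of_aemeasurable (by fun_prop) hg.aemeasurable,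
      AEMeasurable.map_map_of_aemeasurable (by fun_prop) hg'.aemeasurable] at this
  have := hv'.isGaussian_map
  have key := measure_lt_norm_le (μ'.map fun ω => functionalVector c N fun i => f' (x i.1 i.2) ω)
    (fun L => by
      rw [integral_map hv'.aemeasurable (by fun_prop)]
      exact integral_dual_eq_zero hg' (fun _ => h0' _) (L.comp (functionalVector c N)))
    (a := a) (by
      rw [← hlaw', Measure.map_apply_of_aemeasurable hv.aemeasurable
        (measurableSet_le (by fun_prop) (by fun_prop))]
      refine ha.trans (measure_mono fun ω hω => ?_)
      simp only [Set.mem_preimage, Set.mem_ofPred_eq]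
      rw [functionalVector_apply c x N fun y => f y ω]
      exact (pi_norm_le_iff_of_nonneg ha0).2 fun n => hω n) ht
  rw [Measure.map_apply_of_aemeasurable hv'.aemeasurable
    (measurableSet_lt (by fun_prop) (by fun_prop))] at key
  refine (measure_mono fun ω hω => ?_).trans key
  obtain ⟨n, hn, h⟩ := hω
  simp only [Set.mem_preimage, Set.mem_ofPred_eq]
  rw [functionalVector_apply c x N fun y => f' y ω]
  exact h.trans_le (norm_le_pi_norm (fun n : Fin N => pointFunctional (c n) (x n) fun y => f' y ω)
    ⟨n, hn⟩)

/-- A countable family of linear functionals that is almost surely bounded has a large quantile. -/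
lemma exists_quantile [IsProbabilityMeasure μ] (Y : ℕ → Ω → ℝ)
    (hb : ∀ᵐ ω ∂μ, ∃ M, ∀ n, |Y n ω| ≤ M) :
    ∃ a : ℝ, 0 < a ∧ 3 / 4 ≤ μ {ω | ∀ n, |Y n ω| ≤ a} := by
  set B : ℕ → Set Ω := fun k => {ω | ∀ n, |Y n ω| ≤ k + 1}
  have hB : Monotone B := fun k l hkl ω h n => (h n).trans (by gcongr)
  have hU : μ (⋃ k, B k) = 1 := by
    refine le_antisymm prob_le_one ?_
    rw [← measure_univ (μ := μ)]
    refine measure_mono_ae ?_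
    filter_upwards [hb] with ω ⟨M, hM⟩ _
    obtain ⟨k, hk⟩ := exists_nat_ge M
    exact Set.mem_iUnion.2 ⟨k, fun n => (hM n).trans (by linarith)⟩
  rw [hB.measure_iUnion] at hU
  have : (3 / 4 : ℝ≥0∞) < ⨆ k, μ (B k) := by
    rw [hU, ← ENNReal.toReal_lt_toReal (by finiteness) (by finiteness)]
    norm_num
  obtain ⟨k, hk⟩ := lt_iSup_iff.1 this
  exact ⟨k + 1, by positivity, hk.le⟩

end Field

/-! ### The interpolation defect along a segment -/

/-- A nonzero vector of norm at most `1` and a point of the unit interval. -/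
abbrev DefectIndex : Type := {q : Plane × ℝ // q.1 ≠ 0 ∧ ‖q.1‖ ≤ 1 ∧ q.2 ∈ Set.Icc (0 : ℝ) 1}

instance : Nonempty DefectIndex :=
  ⟨⟨((1, 0), 0), by simp, by simp [Prod.norm_def], by simp⟩⟩

/-- The nodes `0`, `w` and `s w`. -/
def defectPoint (q : DefectIndex) : Fin 3 → Plane := ![0, q.1.1, q.1.2 • q.1.1]

/-- The weights of the rescaled linear interpolation error. -/
noncomputable def defectCoeff (q : DefectIndex) : Fin 3 → ℝ :=
  ![(1 - q.1.2) / ‖q.1.1‖ ^ 2, q.1.2 / ‖q.1.1‖ ^ 2, -1 / ‖q.1.1‖ ^ 2]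

/-- The error of linear interpolation of `g` along the segment `[0, w]`, rescaled by `‖w‖²`. -/
noncomputable def defect (q : DefectIndex) (g : Plane → ℝ) : ℝ :=
  pointFunctional (defectCoeff q) (defectPoint q) g

lemma defect_eq (q : DefectIndex) (g : Plane → ℝ) :
    defect q g = ((1 - q.1.2) * g 0 + q.1.2 * g q.1.1 - g (q.1.2 • q.1.1)) / ‖q.1.1‖ ^ 2 := by
  simp only [defect, pointFunctional, defectCoeff, defectPoint, Fin.sum_univ_three]
  simp
  ring

lemma continuous_defect {g : Plane → ℝ} (hg : Continuous g) :
    Continuous fun q : DefectIndex => defect q g := by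
  simp_rw [defect_eq]
  refine Continuous.div (by fun_prop) (by fun_prop) fun q => ?_
  exact pow_ne_zero _ (norm_ne_zero_iff.2 q.2.1)

/-- Continuity and the strict inequality reduce the uncountable family of defects to a countable
one, as `tail_of_quantile` requires. -/
lemma exists_denseSeq_lt_defect {g : Plane → ℝ} (hg : Continuous g) {t : ℝ} {q : DefectIndex}
    (hq : t < defect q g) :
    ∃ n, t < |defect (TopologicalSpace.denseSeq DefectIndex n) g| := by
  obtain ⟨q', hq', n, rfl⟩ := (TopologicalSpace.denseRange_denseSeq DefectIndex).inter_open_nonempty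
    _ (isOpen_lt continuous_const (continuous_defect hg)) ⟨q, hq⟩
  exact ⟨n, lt_of_lt_of_le hq' (le_abs_self _)⟩

/-- A `C²` function has bounded second differences. -/
lemma exists_abs_defect_le {g : Plane → ℝ} (hg : ContDiff ℝ 2 g) :
    ∃ M, ∀ q : DefectIndex, |defect q g| ≤ M := by
  have hD : ContDiff ℝ 1 (fderiv ℝ g) := hg.fderiv_right (by norm_num)
  have hcont : Continuous (fderiv ℝ (fderiv ℝ g)) := hD.continuous_fderiv (by norm_num)
  obtain ⟨K, hK⟩ := ((isCompact_closedBall (0 : Plane) 1).image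
    (Continuous.norm (E := Plane →L[ℝ] Plane →L[ℝ] ℝ) (f := fderiv ℝ (fderiv ℝ g)) hcont)).bddAbove
  replace hK : ∀ x ∈ Metric.closedBall (0 : Plane) 1, ‖fderiv ℝ (fderiv ℝ g) x‖ ≤ K :=
    fun x hx => hK ⟨x, hx, rfl⟩
  have hK0 : 0 ≤ K := (norm_nonneg (fderiv ℝ (fderiv ℝ g) 0)).trans (hK 0 (by simp))
  have hlip : ∀ x ∈ Metric.closedBall (0 : Plane) 1, ‖fderiv ℝ g x - fderiv ℝ g 0‖ ≤ K * ‖x‖ := by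
    intro x hx
    simpa using (convex_closedBall (0 : Plane) 1).norm_image_sub_le_of_norm_fderiv_le
      (fun y _ => (hD.differentiable (by norm_num)).differentiableAt) hK
      (Metric.mem_closedBall_self zero_le_one) hx
  have htaylor : ∀ w : Plane, ‖w‖ ≤ 1 → |g w - g 0 - fderiv ℝ g 0 w| ≤ K * ‖w‖ ^ 2 := by
    intro w hw
    have := (convex_closedBall (0 : Plane) ‖w‖).norm_image_sub_le_of_norm_hasFDerivWithin_le'
      (f := g) (f' := fderiv ℝ g) (φ := fderiv ℝ g 0) (C := K * ‖w‖) (x := 0) (y := w)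
      (fun y _ => ((hg.differentiable (by norm_num)).differentiableAt.hasFDerivAt).hasFDerivWithinAt)
      (fun y hy => by
        have hy' : ‖y‖ ≤ ‖w‖ := by simpa using hy
        refine (hlip y (by simpa using hy'.trans hw)).trans ?_
        gcongr) (by simp) (by simp)
    simpa [sq, mul_assoc] using this
  refine ⟨2 * K, fun q => ?_⟩
  obtain ⟨⟨w, s⟩, hw0, hw1, hs0, hs1⟩ := q
  simp only at hw0 hw1 hs0 hs1
  have hpos : 0 < ‖w‖ ^ 2 := by positivity
  rw [defect_eq, abs_div, abs_of_pos hpos, div_le_iff₀ hpos]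
  simp only
  have hsw : ‖s • w‖ ≤ ‖w‖ := by
    rw [norm_smul, Real.norm_of_nonneg hs0]
    exact mul_le_of_le_one_left (norm_nonneg _) hs1
  have h1 := htaylor w hw1
  have h2 := (htaylor (s • w) (hsw.trans hw1)).trans (by gcongr : _ ≤ K * ‖w‖ ^ 2)
  rw [map_smul, smul_eq_mul] at h2
  have h3 : |s * (g w - g 0 - fderiv ℝ g 0 w)| ≤ K * ‖w‖ ^ 2 := by
    rw [abs_mul, abs_of_nonneg hs0]
    exact (mul_le_of_le_one_left (abs_nonneg _) hs1).trans h1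
  -- Linear interpolation is exact on affine functions, so only the two Taylor remainders survive,
  -- each at most `K * ‖w‖ ^ 2`.
  calc _ = |s * (g w - g 0 - fderiv ℝ g 0 w) - (g (s • w) - g 0 - s * fderiv ℝ g 0 w)| := by
        congr 1; ring
    _ ≤ _ := (abs_sub _ _).trans (by linarith)

/-! ### Edges along which the field dips -/

/-- The field is large at both ends of the segment `[y, y + w]` but not along it. -/
def dipEvent {Ω : Type*} (f : Plane → Ω → ℝ) (p : ℝ) (y w : Plane) : Set Ω :=
  {ω | -(p / 2) ≤ f y ω ∧ -(p / 2) ≤ f (y + w) ω ∧ ∃ s ∈ Set.Icc (0 : ℝ) 1, f (y + s • w) ω < -p}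

/-- The dips have Gaussian tails, at a rate depending only on the covariance function. -/
lemma exists_dip_rate.{u} (κ : Plane → ℝ) : ∃ c : ℝ, 0 < c ∧
    ∀ (Ω : Type u) [MeasurableSpace Ω] (μ : Measure Ω) [IsProbabilityMeasure μ] (f : Plane → Ω → ℝ),
      IsStandardField μ f → HasCovariance μ f κ → (∀ᵐ ω ∂μ, ContDiff ℝ 2 fun x => f x ω) →
      ∀ p : ℝ, 0 < p → ∀ ε : ℝ, 0 < ε → ε ≤ 1 → ∀ y w : Plane, w ≠ 0 → ‖w‖ ≤ ε →
        μ.real (dipEvent f p y w) ≤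
          ferniqueConst.toReal * Real.exp (-(c * p ^ 2 * ε ^ (-4 : ℤ))) := by
  -- The rate must be chosen before the field. It comes from the quantile of one reference field
  -- with covariance `κ`; without such a field the claim is vacuous.
  by_cases hex : ∃ (Ω : Type u) (_ : MeasurableSpace Ω) (μ : Measure Ω) (f : Plane → Ω → ℝ),
    IsProbabilityMeasure μ ∧
      IsStandardField μ f ∧ HasCovariance μ f κ ∧ ∀ᵐ ω ∂μ, ContDiff ℝ 2 fun x => f x ω
  swap
  · refine ⟨1, one_pos, fun Ω _ μ _ f h1 h2 h3 => (hex ⟨Ω, _, μ, f, ‹_›, h1, h2, h3⟩).elim⟩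
  obtain ⟨Ω₀, _, μ₀, f₀, _, hf₀, hκ₀, hC₀⟩ := hex
  set q := TopologicalSpace.denseSeq DefectIndex
  obtain ⟨a, ha0, ha⟩ := exists_quantile (μ := μ₀) (fun n ω => defect (q n) fun x => f₀ x ω) (by
    filter_upwards [hC₀] with ω hω
    obtain ⟨M, hM⟩ := exists_abs_defect_le hω
    exact ⟨M, fun n => hM _⟩)
  refine ⟨Fernique.logRatio (3 / 4) * a⁻¹ ^ 2 / 4,
    by have := logRatio_three_quarters_pos; positivity, ?_⟩
  intro Ω _ μ _ f hf hκ _ p hp ε hε hε1 y w hw0 hw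
  -- The translate of `f` by `y` again has covariance `κ`, so the quantile of `f₀` at the origin
  -- controls edges starting anywhere.
  have htail := tail_of_quantile (f := f₀) (f' := fun x => f (y + x)) hf₀.gaussian
    (hf.gaussian.comp_right fun x => y + x) hf₀.centered (fun x => hf.centered _)
    (fun x x' => by rw [hκ₀, hκ]; congr 1; abel)
    (fun n => defectCoeff (q n)) (fun n => defectPoint (q n)) ha0.le ha
    (t := p / (2 * ε ^ 2)) (by positivity)
  have hsub : μ (dipEvent f p y w) ≤ μ {ω | ∃ n, p / (2 * ε ^ 2) <
      |pointFunctional (defectCoeff (q n)) (defectPoint (q n)) fun x => f (y + x) ω|} := by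
    refine measure_mono_ae ?_
    filter_upwards [hf.continuous] with ω hω hdip
    obtain ⟨h1, h2, s, hs, h3⟩ := hdip
    refine exists_denseSeq_lt_defect (g := fun x => f (y + x) ω)
      (hω.comp (continuous_const.add continuous_id)) (q := ⟨(w, s), hw0, hw.trans hε1, hs⟩) ?_
    have hpos : 0 < ‖w‖ ^ 2 := by positivity
    rw [defect_eq]
    simp only [add_zero]
    -- The interpolated value is at least `-p/2`, the actual one is below `-p`.
    have hnum : p / 2 < (1 - s) * f y ω + s * f (y + w) ω - f (y + s • w) ω := by
      nlinarith [mul_le_mul_of_nonneg_left h1 (sub_nonneg.2 hs.2), mul_le_mul_of_nonneg_left h2 hs.1]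
    calc p / (2 * ε ^ 2) = p / 2 / ε ^ 2 := by rw [div_div]
      _ ≤ p / 2 / ‖w‖ ^ 2 := by gcongr
      _ < _ := by gcongr
  have := ENNReal.toReal_mono
    (ENNReal.mul_ne_top ferniqueConst_lt_top.ne ENNReal.ofReal_ne_top) (hsub.trans htail)
  rw [ENNReal.toReal_mul, ENNReal.toReal_ofReal (Real.exp_pos _).le] at this
  refine this.trans_eq ?_
  congr 3
  rw [zpow_neg]
  norm_cast
  field_simp
  norm_num

/-! ### Counting the edges that meet a rectangle -/

/-- The point with half-integer coordinates `(i / 2, j / 2)`. -/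
noncomputable def halfPoint (q : ℤ × ℤ) : Plane := ((q.1 : ℝ) / 2, (q.2 : ℝ) / 2)

lemma exists_eq_halfPoint {x : Plane} (hx : x ∈ cornerPoints ∨ x ∈ centerPoints) :
    ∃ q, x = halfPoint q := by
  rcases hx with ⟨m, n, rfl⟩ | ⟨m, n, rfl⟩
  · exact ⟨(2 * m, 2 * n), by simp [halfPoint]⟩
  · refine ⟨(2 * m + 1, 2 * n + 1), ?_⟩
    simp only [halfPoint, Prod.mk.injEq]
    push_cast
    constructor <;> ring

/-- The nonzero steps with coordinates at most `1`, in units of `1 / 2`. -/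
noncomputable def stepFinset : Finset (ℤ × ℤ) := {q ∈ Finset.Icc (-2) 2 ×ˢ Finset.Icc (-2) 2 | q ≠ 0}

lemma halfPoint_ne_zero {q : ℤ × ℤ} (hq : q ∈ stepFinset) : halfPoint q ≠ 0 := by
  intro h
  refine (Finset.mem_filter.1 hq).2 ?_
  simp only [halfPoint, Prod.mk_eq_zero, div_eq_zero_iff, Int.cast_eq_zero] at h
  ext <;> simp_all

lemma norm_halfPoint_le {q : ℤ × ℤ} (hq : q ∈ stepFinset) : ‖halfPoint q‖ ≤ 1 := by
  have h := (Finset.mem_filter.1 hq).1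
  simp only [Finset.mem_product, Finset.mem_Icc] at h
  obtain ⟨⟨h1, h2⟩, h3, h4⟩ := h
  have h1' : (-2 : ℝ) ≤ q.1 := by exact_mod_cast h1
  have h2' : (q.1 : ℝ) ≤ 2 := by exact_mod_cast h2
  have h3' : (-2 : ℝ) ≤ q.2 := by exact_mod_cast h3
  have h4' : (q.2 : ℝ) ≤ 2 := by exact_mod_cast h4
  simp only [halfPoint, Prod.norm_def, Real.norm_eq_abs, sup_le_iff, abs_le]
  refine ⟨⟨?_, ?_⟩, ?_, ?_⟩ <;> linarith

/-- Half-integer coordinates treat all kinds of edges at once. The family of pairs is larger than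
the edge set, which is harmless for a union bound. -/
lemma latticeAdj_exists_step {x y : Plane} (h : LatticeAdj x y) :
    ∃ q, ∃ r ∈ stepFinset, x = halfPoint q ∧ y = halfPoint q + halfPoint r := by
  obtain ⟨hx, hy, h1, h2, h3⟩ : (x ∈ cornerPoints ∨ x ∈ centerPoints) ∧
      (y ∈ cornerPoints ∨ y ∈ centerPoints) ∧ |y.1 - x.1| ≤ 1 ∧ |y.2 - x.2| ≤ 1 ∧
      0 < |y.1 - x.1| + |y.2 - x.2| := by
    have a1 := abs_nonneg (y.1 - x.1)
    have a2 := abs_nonneg (y.2 - x.2)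
    rcases h with ⟨hx, hy, h⟩ | ⟨hx, hy, h, h'⟩ | ⟨hx, hy, h, h'⟩
    · exact ⟨.inl hx, .inl hy, by linarith, by linarith, by linarith⟩
    · exact ⟨.inl hx, .inr hy, by linarith, by linarith, by linarith⟩
    · exact ⟨.inr hx, .inl hy, by linarith, by linarith, by linarith⟩
  obtain ⟨⟨i, j⟩, rfl⟩ := exists_eq_halfPoint hx
  obtain ⟨⟨i', j'⟩, rfl⟩ := exists_eq_halfPoint hy
  simp only [halfPoint, abs_le] at h1 h2 h3
  refine ⟨(i, j), (i' - i, j' - j), ?_, rfl, ?_⟩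
  · have e1 : (-2 : ℝ) ≤ i' - i := by linarith
    have e2 : (i' - i : ℝ) ≤ 2 := by linarith
    have e3 : (-2 : ℝ) ≤ j' - j := by linarith
    have e4 : (j' - j : ℝ) ≤ 2 := by linarith
    simp only [stepFinset, Finset.mem_filter, Finset.mem_product, Finset.mem_Icc]
    refine ⟨⟨⟨?_, ?_⟩, ?_, ?_⟩, fun h0 => ?_⟩
    · exact_mod_cast e1
    · exact_mod_cast e2
    · exact_mod_cast e3
    · exact_mod_cast e4
    · rw [Prod.mk_eq_zero, sub_eq_zero, sub_eq_zero] at h0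
      simp [h0.1, h0.2] at h3
  · simp only [halfPoint, Prod.mk_add_mk, Prod.mk.injEq]
    push_cast
    constructor <;> ring

/-- The starting points of the edges that can meet the rectangle `[0,2R] × [0,R]`. -/
noncomputable def startFinset (ε R : ℝ) : Finset (ℤ × ℤ) :=
  Finset.Icc (-2) (⌊4 * R / ε⌋ + 2) ×ˢ Finset.Icc (-2) (⌊2 * R / ε⌋ + 2)

lemma card_Icc_floor_le {b : ℝ} (hb : 0 ≤ b) : ((Finset.Icc (-2) (⌊b⌋ + 2)).card : ℝ) ≤ b + 5 := by
  have h0 : 0 ≤ ⌊b⌋ := Int.floor_nonneg.2 hb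
  have : ((Finset.Icc (-2) (⌊b⌋ + 2)).card : ℤ) = ⌊b⌋ + 5 := by
    rw [Int.card_Icc, Int.toNat_of_nonneg (by linarith)]
    ring
  have h : ((Finset.Icc (-2) (⌊b⌋ + 2)).card : ℝ) = ⌊b⌋ + 5 := by exact_mod_cast this
  rw [h]
  linarith [Int.floor_le b]

lemma card_edges_le {ε R : ℝ} (hε : 0 < ε) (hε1 : ε ≤ 1) (hR : 1 < R) :
    ((startFinset ε R ×ˢ stepFinset).card : ℝ) ≤ 1575 * R ^ 2 * ε ^ (-2 : ℤ) := by
  have hu : 1 ≤ R / ε := (one_le_div hε).2 (hε1.trans hR.le)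
  have hstep : (stepFinset.card : ℝ) ≤ 25 := by
    have : stepFinset.card ≤ 25 := (Finset.card_filter_le _ _).trans (by simp)
    exact_mod_cast this
  have h1 := card_Icc_floor_le (b := 4 * R / ε) (by positivity)
  have h2 := card_Icc_floor_le (b := 2 * R / ε) (by positivity)
  rw [mul_div_assoc] at h1 h2
  rw [startFinset, Finset.card_product, Finset.card_product, mul_div_assoc, mul_div_assoc]
  push_cast
  -- As `1 ≤ R / ε`, the additive `5`s are absorbed: `4 + 5 = 9`, `2 + 5 = 7`, and `9 * 7 * 25 =
  -- 1575`.
  calc _ ≤ (9 * (R / ε)) * (7 * (R / ε)) * 25 := by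
        gcongr
        · linarith
        · linarith
    _ = 1575 * R ^ 2 * ε ^ (-2 : ℤ) := by
        rw [zpow_neg]
        norm_cast
        field_simp
        norm_num

/-- Indices count steps of `ε / 2`, so a distance `ε` costs a margin of `2` on each side. -/
lemma mem_Icc_of_dist_le {ε L u : ℝ} {i : ℤ} (hε : 0 < ε) (hu : u ∈ Set.Icc 0 L)
    (hd : |u - ε * (i / 2)| ≤ ε) : i ∈ Finset.Icc (-2) (⌊2 * L / ε⌋ + 2) := by
  rw [abs_le] at hd
  rw [Finset.mem_Icc, ← sub_le_iff_le_add, Int.le_floor]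
  constructor
  · have : (-2 : ℝ) ≤ i := by
      by_contra! h
      nlinarith [hu.1]
    exact_mod_cast this
  · push_cast
    rw [le_div_iff₀ hε]
    nlinarith [hu.2]

/-- The edges of the scaled lattice that meet the rectangle belong to a small finite family. -/
lemma mem_startFinset {ε R : ℝ} (hε : 0 < ε) {q r : ℤ × ℤ} (hr : r ∈ stepFinset) {s : ℝ}
    (hs : s ∈ Set.Icc (0 : ℝ) 1)
    (hx : ε • halfPoint q + s • ε • halfPoint r ∈ rectangle (2 * R) R) :
    q ∈ startFinset ε R := by
  have hn : ‖s • ε • halfPoint r‖ ≤ ε := by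
    rw [norm_smul, norm_smul, Real.norm_of_nonneg hs.1, Real.norm_of_nonneg hε.le]
    calc s * (ε * ‖halfPoint r‖) ≤ 1 * (ε * 1) := by
          have := hs.2
          have := norm_halfPoint_le hr
          have := hs.1
          gcongr
      _ = ε := by ring
  rw [Prod.norm_def, sup_le_iff] at hn
  obtain ⟨h1, h2⟩ := hx
  simp only [Prod.fst_add, Prod.smul_fst, Prod.snd_add, Prod.smul_snd, smul_eq_mul,
    Real.norm_eq_abs] at h1 h2 hn
  rw [startFinset, Finset.mem_product]
  constructor
  · have := mem_Icc_of_dist_le (i := q.1) hε h1 (by simpa [halfPoint] using hn.1)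
    rwa [← mul_assoc, show (2 * 2 : ℝ) = 4 by norm_num] at this
  · exact mem_Icc_of_dist_le (i := q.2) hε h2 (by simpa [halfPoint] using hn.2)

/-! ### Comparison of the crossing events -/

/-- A discrete crossing without continuum crossing forces a dip along some edge. -/
lemma discreteCrossEvent_diff_subset {Ω : Type*} (f : Plane → Ω → ℝ) {p ε R : ℝ} (hp : 0 < p)
    (hε : 0 < ε) :
    discreteCrossEvent f ε (p / 2) (2 * R) R \ crossEvent f p (2 * R) R ⊆
      ⋃ e ∈ startFinset ε R ×ˢ stepFinset,
        dipEvent f p (ε • halfPoint e.1) (ε • halfPoint e.2) := by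
  rintro ω ⟨⟨a, b, ha, hb, hab⟩, hcross⟩
  by_contra hdip
  refine hcross ⟨a, b, ha, hb, hab.mono fun x ⟨hx, hrect⟩ => ⟨?_, hrect⟩⟩
  rcases hx with ⟨_, hx⟩ | ⟨y₁, y₂, ⟨a₁, a₂, hadj, rfl, rfl⟩, hx, h1, h2⟩
  · exact (show -p ≤ -(p / 2) by linarith).trans hx
  · obtain ⟨q, r, hr, rfl, rfl⟩ := latticeAdj_exists_step hadj
    rw [segment_eq_image'] at hx
    obtain ⟨s, hs, rfl⟩ := hx
    simp only [smul_add, add_sub_cancel_left] at hrect h2 ⊢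
    by_contra hlt
    refine hdip (Set.mem_iUnion₂.2 ⟨(q, r), ?_, h1, h2, s, hs, not_le.1 hlt⟩)
    exact Finset.mem_product.2 ⟨mem_startFinset hε hr hs hrect, hr⟩

/-- The bound on the probability of the difference decays when the mesh decays faster than
`log ^ (-1/4)`. -/
lemma tendsto_bound {C c δ : ℝ} (hC : 0 ≤ C) (hc : 0 < c) (hδ : 0 < δ) {ε : ℝ → ℝ}
    (hε : ∀ᶠ R in atTop, 0 < ε R ∧ ε R ≤ Real.log R ^ (-(1 / 4 + δ))) :
    Tendsto (fun R => C * R ^ 2 * ε R ^ (-2 : ℤ) * Real.exp (-c * ε R ^ (-4 : ℤ))) atTop (𝓝 0) := by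
  have hlim : Tendsto (fun R : ℝ => C * (2 / c) *
      Real.exp (-(Real.log R * (c / 2 * Real.log R ^ (4 * δ) - 2)))) atTop (𝓝 0) := by
    rw [← mul_zero (C * (2 / c))]
    refine (Real.tendsto_exp_neg_atTop_nhds_zero.comp ?_).const_mul _
    refine Real.tendsto_log_atTop.atTop_mul_atTop₀ ?_
    refine tendsto_atTop_add_const_right _ _ (Tendsto.const_mul_atTop (by positivity) ?_)
    exact (tendsto_rpow_atTop (by positivity)).comp Real.tendsto_log_atTop
  refine squeeze_zero' ?_ ?_ hlim
  · filter_upwards [hε] with R hR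
    have := hR.1
    positivity
  · filter_upwards [hε, eventually_gt_atTop (Real.exp 1)] with R ⟨h0, hR⟩ hR1
    have hRpos : 0 < R := (Real.exp_pos 1).trans hR1
    have hlog : 1 < Real.log R := (Real.lt_log_iff_exp_lt hRpos).2 hR1
    have hlog0 : 0 < Real.log R := one_pos.trans hlog
    set e := ε R
    set v := e ^ (-2 : ℤ) with hv
    have hv4 : e ^ (-4 : ℤ) = v ^ 2 := by rw [hv, ← zpow_natCast, ← zpow_mul]; norm_num
    have hvpos : 0 < v := by positivity
    have hle : Real.log R * Real.log R ^ (4 * δ) ≤ v ^ 2 := by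
      have h4 : e ^ 4 ≤ Real.log R ^ (-(1 + 4 * δ)) := by
        calc e ^ 4 ≤ (Real.log R ^ (-(1 / 4 + δ))) ^ 4 := by gcongr
          _ = Real.log R ^ (-(1 + 4 * δ)) := by
            rw [← Real.rpow_natCast, ← Real.rpow_mul hlog0.le]
            congr 1
            push_cast
            ring
      rw [Real.rpow_neg hlog0.le] at h4
      have := inv_anti₀ (by positivity) h4
      rw [inv_inv, Real.rpow_add hlog0, Real.rpow_one] at this
      rw [← hv4, zpow_neg]
      exact_mod_cast this
    have hv1 : 1 ≤ v := by
      have : 1 ≤ Real.log R ^ (4 * δ) := Real.one_le_rpow hlog.le (by positivity)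
      nlinarith
    -- Half of the exponential decay absorbs the factor `v = e⁻²`; the other half, at least `c / 2 *
    -- log R ^ (1 + 4δ)` in the exponent, beats `R ^ 2`.
    have hvexp : v ≤ 2 / c * Real.exp (c / 2 * v ^ 2) := by
      have h1 : c / 2 * v ^ 2 ≤ Real.exp (c / 2 * v ^ 2) :=
        (le_add_of_nonneg_right zero_le_one).trans (Real.add_one_le_exp _)
      calc v ≤ v ^ 2 := by nlinarith
        _ = 2 / c * (c / 2 * v ^ 2) := by field_simp
        _ ≤ _ := by gcongr
    rw [hv4]
    calc C * R ^ 2 * v * Real.exp (-c * v ^ 2)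
        ≤ C * R ^ 2 * (2 / c * Real.exp (c / 2 * v ^ 2)) * Real.exp (-c * v ^ 2) := by gcongr
      _ = C * (2 / c) * (R ^ 2 * (Real.exp (c / 2 * v ^ 2) * Real.exp (-c * v ^ 2))) := by ring
      _ = C * (2 / c) * Real.exp (2 * Real.log R - c / 2 * v ^ 2) := by
        rw [← Real.exp_add, show R ^ 2 = Real.exp (2 * Real.log R) by
          rw [two_mul, Real.exp_add, Real.exp_log hRpos, sq], ← Real.exp_add]
        congr 2
        ring
      _ ≤ _ := by
        gcongr
        nlinarith

end PlanarPercolation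

theorem proposition2p15 :
    ∃ C₁ : ℝ, ∀ (κ : PlanarPercolation.Plane → ℝ) (p : ℝ), 0 < p →
      ∃ c₂ : ℝ, 0 < c₂ ∧ ∃ ε₀ : ℝ, 0 < ε₀ ∧
        ∀ (Ω : Type*) [MeasurableSpace Ω] (μ : Measure Ω) [IsProbabilityMeasure μ]
          (f : PlanarPercolation.Plane → Ω → ℝ),
          PlanarPercolation.IsStandardField μ f →
          PlanarPercolation.HasCovariance μ f κ →
          (∀ᵐ ω ∂μ, ContDiff ℝ 2 fun x => f x ω) →
          (∀ ε : ℝ, 0 < ε → ε ≤ ε₀ → ∀ R : ℝ, 1 < R →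
            μ.real (PlanarPercolation.discreteCrossEvent f ε (p / 2) (2 * R) R \
                PlanarPercolation.crossEvent f p (2 * R) R)
              ≤ C₁ * R ^ 2 * ε ^ (-2 : ℤ) * Real.exp (-c₂ * ε ^ (-4 : ℤ))) ∧
          (∀ ε : ℝ → ℝ, ∀ δ : ℝ, 0 < δ →
            (∀ᶠ R in atTop, 0 < ε R ∧ ε R ≤ Real.log R ^ (-(1 / 4 + δ))) →
            Tendsto (fun R : ℝ =>
              μ.real (PlanarPercolation.discreteCrossEvent f (ε R) (p / 2) (2 * R) R \
                PlanarPercolation.crossEvent f p (2 * R) R)) atTop (𝓝 0)) := by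
  refine ⟨1575 * PlanarPercolation.ferniqueConst.toReal, fun κ p hp => ?_⟩
  obtain ⟨c, hc, hrate⟩ := PlanarPercolation.exists_dip_rate κ
  -- `ε₀ = 1` suffices, since `DefectIndex` allows all steps of norm at most `1`.
  refine ⟨c * p ^ 2, by positivity, 1, one_pos, fun Ω _ μ _ f hf hκ hC => ?_⟩
  have hbound : ∀ ε : ℝ, 0 < ε → ε ≤ 1 → ∀ R : ℝ, 1 < R →
      μ.real (PlanarPercolation.discreteCrossEvent f ε (p / 2) (2 * R) R \
        PlanarPercolation.crossEvent f p (2 * R) R) ≤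
        1575 * PlanarPercolation.ferniqueConst.toReal * R ^ 2 * ε ^ (-2 : ℤ) *
          Real.exp (-(c * p ^ 2) * ε ^ (-4 : ℤ)) := by
    intro ε hε hε1 R hR
    refine (measureReal_mono (PlanarPercolation.discreteCrossEvent_diff_subset f hp hε) (measure_ne_top _ _)).trans
      ((measureReal_biUnion_finset_le _ _).trans ?_)
    refine (Finset.sum_le_card_nsmul _ _ _ fun e he => hrate Ω μ f hf hκ hC p hp ε hε hε1 _ _
      (smul_ne_zero hε.ne' (PlanarPercolation.halfPoint_ne_zero (Finset.mem_product.1 he).2)) ?_).trans ?_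
    · rw [norm_smul, Real.norm_of_nonneg hε.le]
      exact mul_le_of_le_one_right hε.le (PlanarPercolation.norm_halfPoint_le (Finset.mem_product.1 he).2)
    · rw [nsmul_eq_mul, ← neg_mul]
      calc _ ≤ 1575 * R ^ 2 * ε ^ (-2 : ℤ) * (PlanarPercolation.ferniqueConst.toReal *
            Real.exp (-(c * p ^ 2) * ε ^ (-4 : ℤ))) := by
            gcongr
            exact PlanarPercolation.card_edges_le hε hε1 hR
        _ = _ := by ring
  refine ⟨hbound, fun ε δ hδ hε => ?_⟩
  refine squeeze_zero' (Eventually.of_forall fun _ => measureReal_nonneg) ?_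
    (PlanarPercolation.tendsto_bound (C := 1575 * PlanarPercolation.ferniqueConst.toReal) (c := c * p ^ 2) (by positivity)
      (by positivity) hδ hε)
  have hlog : Tendsto (fun R => Real.log R ^ (-(1 / 4 + δ))) atTop (𝓝 0) :=
    (tendsto_rpow_neg_atTop (by positivity)).comp Real.tendsto_log_atTop
  filter_upwards [hε, hlog.eventually (ge_mem_nhds one_pos), eventually_gt_atTop 1] with R h h1 hR
  exact hbound _ h.1 (h.2.trans h1) R hR
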